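/- Let $d\ge 2$, let $\hbar,m,\epsilon_0>0$ and $q\in\mathbb{R}\setminus\{0\}$. Let $\omega:\mathbb{R}^d\to[0,\infty)$ be a Borel function with $\omega(k)>0$ for almost every $k$, and let $\hat\rho:\mathbb{R}^d\to\mathbb{R}$ be a Borel function depending only on $|k|$ such that $\hat\rho/\omega^{1/2}$ and $\hat\rho/\omega^{3/2}$ belong to $L^2(\mathbb{R}^d)\setminus\{0\}$. Put \[ a:=\frac{d-1}{4d}\,\frac{\hbar q^2}{\epsilon_0 m^2}\int_{\mathbb{R}^d}\frac{|\hat\rho(k)|^2}{\omega(k)^3}\,dk . \] For a real Borel function $W$ on $\mathbb{R}^d$, the quadratic form of the operator of multiplication by $W$ on $L^2(\mathbb{R}^d)$ is $\psi\mapsto\int W|\psi|^2$ on $\mathrm{dom}(|W|^{1/2})=\{\psi\in L^2:|W|^{1/2}\psi\in L^2\}$; the form of $-\Delta$ is $\psi\mapsto\|(-\Delta)^{1/2}\psi\|^2$ on $\mathrm{dom}(|\Delta|^{1/2})=H^1(\mathbb{R}^d)$. We say that $W$ is infinitesimally form-bounded with respect to $-\Delta$ if $H^1(\mathbb{R}^d)\subset\mathrm{dom}(|W|^{1/2})$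 and for every $\alpha>0$ there is $\beta\ge0$ with $\int|W||\psi|^2\le\alpha\|(-\Delta)^{1/2}\psi\|^2+\beta\|\psi\|^2$ for all $\psi\in H^1(\mathbb{R}^d)$. Let $V:\mathbb{R}^d\to\mathbb{R}$ be a Borel function such that (V.1) either (V.1-1) $|V|$ is infinitesimally form-bounded with respect to $-\Delta$, or (V.1-2) $V$ is bounded from below; (V.2) $\int_{\mathbb{R}^d}|V(x)|e^{-t|x|^2}\,dx<\infty$ for all $t>0$. Then the integral in \[ V_{\mathrm{eff}}(x):=\frac{1}{(4\pi a)^{d/2}}\int_{\mathbb{R}^d}V(y)\,e^{-|x-y|^2/(4a)}\,dy,\qquad x\in\mathbb{R}^d, \] converges absolutely for every $x$, and the quadratic form sum \[ H_{\mathrm{eff}}:=-\frac{\hbar^2}{2m}\Delta\,\dot{+}\,V_{\mathrm{eff}} \] exists: the form $\psi\mapsto\frac{\hbar^2}{2m}\|(-\Delta)^{1/2}\psi\|^2+\int V_{\mathrm{eff}}|\psi|^2$ on $H^1(\mathbb{R}^d)\cap\mathrm{dom}(|V_{\mathrm{eff}}|^{1/2})$ is densely defined, bounded from below and closed. Consequently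 there is a unique operator $H_{\mathrm{eff}}$ associated with this form which is self-adjoint and bounded from below. In case (V.1-1), $V_{\mathrm{eff}}$ is moreover infinitesimally form-bounded with respect to $-\Delta$. -/

import Mathlib

open MeasureTheory Filter Topology

noncomputable section

/-- The configuration space `ℝ^d` with the Euclidean norm. -/
abbrev Space (d : ℕ) : Type := EuclideanSpace ℝ (Fin d)

/-- The one-particle Hilbert space `L²(ℝ^d)` of complex-valued functions. -/
abbrev L2Space (d : ℕ) : Type := Lp (α := Space d) ℂ 2 volume

/-! ### Quadratic forms on a complex Hilbert space -/

/-- A Hermitian (symmetric) sesquilinear form, conjugate-linear in the first argument and linear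
in the second, defined on a linear subspace of a Hilbert space; equivalently, a real-valued
quadratic form. -/
structure SesqForm (H : Type*) [NormedAddCommGroup H] [InnerProductSpace ℂ H] where
  domain : Submodule ℂ H
  form : domain →ₗ⋆[ℂ] domain →ₗ[ℂ] ℂ
  hermitian : ∀ φ ψ : domain, form φ ψ = starRingEnd ℂ (form ψ φ)

namespace SesqForm

variable {H K : Type*} [NormedAddCommGroup H] [InnerProductSpace ℂ H]
  [NormedAddCommGroup K] [InnerProductSpace ℂ K]

/-- The (real) value `q(ψ) = q(ψ, ψ)` of the quadratic form. -/
def quad (q : SesqForm H) (ψ : q.domain) : ℝ := (q.form ψ ψ).re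

/-- The sum `q₁ + q₂` of two forms, with domain `Q(q₁) ∩ Q(q₂)`. -/
def add (q₁ q₂ : SesqForm H) : SesqForm H where
  domain := q₁.domain ⊓ q₂.domain
  form := LinearMap.mk₂'ₛₗ (starRingEnd ℂ) (RingHom.id ℂ)
    (fun φ ψ => q₁.form ⟨φ, φ.2.1⟩ ⟨ψ, ψ.2.1⟩ + q₂.form ⟨φ, φ.2.2⟩ ⟨ψ, ψ.2.2⟩)
    (fun φ φ' ψ => by
      have h1 := q₁.form.map_add₂ ⟨φ, φ.2.1⟩ ⟨φ', φ'.2.1⟩ ⟨ψ, ψ.2.1⟩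
      have h2 := q₂.form.map_add₂ ⟨φ, φ.2.2⟩ ⟨φ', φ'.2.2⟩ ⟨ψ, ψ.2.2⟩
      exact (congrArg₂ (· + ·) h1 h2).trans (by ring))
    (fun c φ ψ => by
      have h1 := q₁.form.map_smulₛₗ₂ c ⟨φ, φ.2.1⟩ ⟨ψ, ψ.2.1⟩
      have h2 := q₂.form.map_smulₛₗ₂ c ⟨φ, φ.2.2⟩ ⟨ψ, ψ.2.2⟩
      exact (congrArg₂ (· + ·) h1 h2).trans (smul_add _ _ _).symm)
    (fun φ ψ ψ' => by
      have h1 := (q₁.form ⟨φ, φ.2.1⟩).map_add ⟨ψ, ψ.2.1⟩ ⟨ψ', ψ'.2.1⟩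
      have h2 := (q₂.form ⟨φ, φ.2.2⟩).map_add ⟨ψ, ψ.2.2⟩ ⟨ψ', ψ'.2.2⟩
      exact (congrArg₂ (· + ·) h1 h2).trans (by ring))
    (fun c φ ψ => by
      have h1 := (q₁.form ⟨φ, φ.2.1⟩).map_smul c ⟨ψ, ψ.2.1⟩
      have h2 := (q₂.form ⟨φ, φ.2.2⟩).map_smul c ⟨ψ, ψ.2.2⟩
      exact (congrArg₂ (· + ·) h1 h2).trans (smul_add _ _ _).symm)
  hermitian := fun φ ψ => by
    simp only [LinearMap.mk₂'ₛₗ_apply, map_add]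
    rw [q₁.hermitian, q₂.hermitian]

/-- The form `c q`, for a real constant `c`, with the same domain. -/
def smul (c : ℝ) (q : SesqForm H) : SesqForm H where
  domain := q.domain
  form := (c : ℂ) • q.form
  hermitian := fun φ ψ => by
    simp only [LinearMap.smul_apply, smul_eq_mul, map_mul, Complex.conj_ofReal]
    rw [q.hermitian]

/-- The form `(φ, ψ) ↦ q(Uφ, Uψ)` on `U⁻¹ Q(q)`, for a unitary operator `U`. -/
def comap (U : H ≃ₗᵢ[ℂ] K) (q : SesqForm K) : SesqForm H where
  domain := q.domain.comap (U.toLinearEquiv : H →ₗ[ℂ] K)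
  form := LinearMap.mk₂'ₛₗ (starRingEnd ℂ) (RingHom.id ℂ)
    (fun φ ψ => q.form ⟨U φ, φ.2⟩ ⟨U ψ, ψ.2⟩)
    (fun φ φ' ψ => by
      rw [← q.form.map_add₂]; congr 2; exact Subtype.ext (U.map_add _ _))
    (fun c φ ψ => by
      rw [← q.form.map_smulₛₗ₂]; congr 2; exact Subtype.ext (U.map_smul _ _))
    (fun φ ψ ψ' => by
      rw [← (q.form _).map_add]; congr 1; exact Subtype.ext (U.map_add _ _))
    (fun c φ ψ => by
      rw [RingHom.id_apply, ← (q.form _).map_smul]; congr 1; exact Subtype.ext (U.map_smul _ _))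
  hermitian := fun φ ψ => q.hermitian _ _

/-- The form is densely defined. -/
def DenselyDefined (q : SesqForm H) : Prop := Dense (q.domain : Set H)

/-- The form is bounded from below: `q(ψ) ≥ c ‖ψ‖²` for some real `c`. -/
def BoundedBelow (q : SesqForm H) : Prop :=
  ∃ c : ℝ, ∀ ψ : q.domain, c * ‖(ψ : H)‖ ^ 2 ≤ q.quad ψ

/-- The form is closed: if `ψ_n ∈ Q(q)`, `ψ_n → ψ` in `H` and `q(ψ_n - ψ_m) → 0`, then
`ψ ∈ Q(q)` and `q(ψ_n - ψ) → 0`. -/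
def Closed (q : SesqForm H) : Prop :=
  ∀ (u : ℕ → q.domain) (ψ : H),
    Tendsto (fun n => (u n : H)) atTop (𝓝 ψ) →
    Tendsto (fun p : ℕ × ℕ => q.quad (u p.1 - u p.2)) atTop (𝓝 0) →
    ∃ hψ : ψ ∈ q.domain, Tendsto (fun n => q.quad (u n - ⟨ψ, hψ⟩)) atTop (𝓝 0)

/-- `A` is the operator associated with the form `q`: `ψ ∈ dom A` and `A ψ = η` if and only if
`ψ ∈ Q(q)` and `q(φ, ψ) = ⟨φ, η⟩` for all `φ ∈ Q(q)`. -/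
def IsAssociated (q : SesqForm H) (A : H →ₗ.[ℂ] H) : Prop :=
  ∀ ψ η : H, (ψ, η) ∈ A.graph ↔
    ∃ hψ : ψ ∈ q.domain, ∀ φ : q.domain, q.form φ ⟨ψ, hψ⟩ = inner ℂ (φ : H) η

/-- The form sum of `q₁` and `q₂` exists: `q₁ + q₂` on `Q(q₁) ∩ Q(q₂)` is densely defined,
bounded from below and closed. -/
def FormSumExists (q₁ q₂ : SesqForm H) : Prop :=
  (q₁.add q₂).DenselyDefined ∧ (q₁.add q₂).BoundedBelow ∧ (q₁.add q₂).Closed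

/-- `b` is infinitesimally form-bounded with respect to `a`: `Q(a) ⊆ Q(b)`, and for every `α > 0`
there is `β ≥ 0` with `|b(ψ)| ≤ α a(ψ) + β ‖ψ‖²` for all `ψ ∈ Q(a)`. -/
def InfinitesimallyBounded (b a : SesqForm H) : Prop :=
  ∃ hdom : a.domain ≤ b.domain, ∀ α : ℝ, 0 < α → ∃ β : ℝ, 0 ≤ β ∧
    ∀ ψ : a.domain, |b.quad ⟨ψ, hdom ψ.2⟩| ≤ α * a.quad ψ + β * ‖(ψ : H)‖ ^ 2

end SesqForm

/-- The operator `A` is bounded from below: `⟨ψ, A ψ⟩ ≥ c ‖ψ‖²` on `dom A` for some real `c`. -/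
def OperatorBoundedBelow {H : Type*} [NormedAddCommGroup H] [InnerProductSpace ℂ H]
    (A : H →ₗ.[ℂ] H) : Prop :=
  ∃ c : ℝ, ∀ ψ : A.domain, c * ‖(ψ : H)‖ ^ 2 ≤ (inner ℂ (ψ : H) (A ψ)).re

/-! ### The forms of multiplication operators and of `-Δ` -/

/-- `dom(|w|^{1/2}) = {ψ ∈ L² : |w|^{1/2} ψ ∈ L²}`. -/
def multDomain {d : ℕ} (w : Space d → ℝ) : Submodule ℂ (L2Space d) where
  carrier := {ψ | MemLp (fun x => ((√|w x| : ℝ) : ℂ) * ψ x) 2 volume}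
  zero_mem' := by
    have h : (fun x => ((√|w x| : ℝ) : ℂ) * (0 : L2Space d) x) =ᵐ[volume] fun _ => (0 : ℂ) := by
      filter_upwards [Lp.coeFn_zero ℂ 2 (volume : Measure (Space d))] with x hx
      rw [hx]
      exact mul_zero _
    exact (memLp_congr_ae h).2 MemLp.zero'
  add_mem' := fun {φ ψ} hφ hψ => by
    refine (memLp_congr_ae ?_).2 (MemLp.add hφ hψ)
    filter_upwards [Lp.coeFn_add φ ψ] with x hx
    change _ * ((φ + ψ : L2Space d) x) = _
    rw [hx]
    exact mul_add _ _ _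
  smul_mem' := fun c ψ hψ => by
    refine (memLp_congr_ae ?_).2 (MemLp.const_mul hψ c)
    filter_upwards [Lp.coeFn_smul c ψ] with x hx
    simp only [hx, Pi.smul_apply, smul_eq_mul]
    ring

lemma multDomain_integrable {d : ℕ} {w : Space d → ℝ} (hw : Measurable w)
    (φ ψ : multDomain w) :
    Integrable (fun x => (w x : ℂ) * (starRingEnd ℂ (φ.1 x) * ψ.1 x)) volume := by
  have hφ : MemLp (fun x => ((√|w x| : ℝ) : ℂ) * φ.1 x) 2 volume := φ.2
  have hψ : MemLp (fun x => ((√|w x| : ℝ) : ℂ) * ψ.1 x) 2 volume := ψ.2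
  have h := (hφ.norm.integrable_mul hψ.norm)
  refine h.mono' ?_ (Eventually.of_forall fun x => ?_)
  · refine (Complex.measurable_ofReal.comp hw).aestronglyMeasurable.mul ?_
    exact (Complex.continuous_conj.comp_aestronglyMeasurable
      (Lp.aestronglyMeasurable φ.1)).mul (Lp.aestronglyMeasurable ψ.1)
  · have hs := Real.mul_self_sqrt (abs_nonneg (w x))
    simp only [Pi.mul_apply, norm_mul, Complex.norm_real, Real.norm_eq_abs,
      RCLike.norm_conj, abs_of_nonneg (Real.sqrt_nonneg _)]
    exact le_of_eq (by linear_combination (-(‖φ.1 x‖ * ‖ψ.1 x‖)) * hs)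

/-- The quadratic form of the (self-adjoint) operator of multiplication by the real function `w`:
`(φ, ψ) ↦ ∫ w \bar φ ψ` on `dom(|w|^{1/2})`. -/
def multForm {d : ℕ} (w : Space d → ℝ) (hw : Measurable w) : SesqForm (L2Space d) where
  domain := multDomain w
  form := LinearMap.mk₂'ₛₗ (starRingEnd ℂ) (RingHom.id ℂ)
    (fun φ ψ => ∫ x, (w x : ℂ) * (starRingEnd ℂ (φ.1 x) * ψ.1 x))
    (fun φ φ' ψ => by
      rw [← integral_add (multDomain_integrable hw φ ψ) (multDomain_integrable hw φ' ψ)]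
      refine integral_congr_ae ?_
      filter_upwards [Lp.coeFn_add φ.1 φ'.1] with x hx
      simp only [Submodule.coe_add, hx, Pi.add_apply, map_add]
      ring)
    (fun c φ ψ => by
      rw [smul_eq_mul, ← integral_const_mul]
      refine integral_congr_ae ?_
      filter_upwards [Lp.coeFn_smul c φ.1] with x hx
      simp only [Submodule.coe_smul, hx, Pi.smul_apply, smul_eq_mul, map_mul]
      ring)
    (fun φ ψ ψ' => by
      rw [← integral_add (multDomain_integrable hw φ ψ) (multDomain_integrable hw φ ψ')]
      refine integral_congr_ae ?_
      filter_upwards [Lp.coeFn_add ψ.1 ψ'.1] with x hx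
      simp only [Submodule.coe_add, hx, Pi.add_apply]
      ring)
    (fun c φ ψ => by
      rw [RingHom.id_apply, smul_eq_mul, ← integral_const_mul]
      refine integral_congr_ae ?_
      filter_upwards [Lp.coeFn_smul c ψ.1] with x hx
      simp only [Submodule.coe_smul, hx, Pi.smul_apply, smul_eq_mul]
      ring)
  hermitian := fun φ ψ => by
    simp only [LinearMap.mk₂'ₛₗ_apply]
    rw [← integral_conj]
    refine integral_congr_ae (Eventually.of_forall fun x => ?_)
    simp only [map_mul, Complex.conj_ofReal, Complex.conj_conj]
    ring

/-- The quadratic form of `-Δ`, that is `‖(-Δ)^{1/2} ψ‖²` on `dom(|Δ|^{1/2}) = H¹(ℝ^d)`.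
Mathlib's Fourier transform (with kernel `e^{-2π i x·ξ}`) turns `-Δ` into multiplication by
`(2π|ξ|)²`. -/
def negLaplacianForm (d : ℕ) : SesqForm (L2Space d) :=
  SesqForm.comap (Lp.fourierTransformₗᵢ (Space d) ℂ)
    (multForm (fun ξ : Space d => (2 * Real.pi * ‖ξ‖) ^ 2)
      ((measurable_norm.const_mul _).pow_const 2))

/-! ### The effective potential -/

/-- The constant `a = (d-1)/(4d) · ħ q² / (ε₀ m²) · ∫ |ρ̂|² / ω³`. -/
def smearingConst (d : ℕ) (hbar m q ε₀ : ℝ) (ω ρ : Space d → ℝ) : ℝ :=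
  ((d : ℝ) - 1) / (4 * d) * (hbar * q ^ 2 / (ε₀ * m ^ 2)) * ∫ k, |ρ k| ^ 2 / ω k ^ 3

/-- The effective potential
`V_eff(x) = (4πa)^{-d/2} ∫ V(y) e^{-|x-y|²/(4a)} dy`. -/
def effPotential {d : ℕ} (a : ℝ) (V : Space d → ℝ) (x : Space d) : ℝ :=
  1 / (4 * Real.pi * a) ^ ((d : ℝ) / 2) * ∫ y, V y * Real.exp (-‖x - y‖ ^ 2 / (4 * a))

lemma measurable_effPotential {d : ℕ} (a : ℝ) {V : Space d → ℝ} (hV : Measurable V) :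
    Measurable (effPotential a V) := by
  refine Measurable.const_mul ?_ _
  refine (StronglyMeasurable.integral_prod_right
    (f := fun x y => V y * Real.exp (-‖x - y‖ ^ 2 / (4 * a))) ?_).measurable
  refine Measurable.stronglyMeasurable ?_
  exact (hV.comp measurable_snd).mul (by fun_prop)

/-- `|V|` is infinitesimally form-bounded with respect to `-Δ`. -/
def AbsInfinitesimallyFormBounded {d : ℕ} (V : Space d → ℝ) (hV : Measurable V) : Prop :=
  (multForm (fun x => |V x|) hV.abs).InfinitesimallyBounded (negLaplacianForm d)

end

noncomputable section

/-! ### Closed semibounded forms and their self-adjoint operators. -/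

namespace SesqForm

variable {H : Type*} [NormedAddCommGroup H] [InnerProductSpace ℂ H]

/-! Gaussian smearing writes `V_eff` as an average of translates of `V`. Kinetic energy and norm are
translation invariant, since translation only multiplies the Fourier transform by a phase. So a form
bound for `V` holds with the same constants for every translate, and averaging carries it over to
`V_eff` (`multEnergy_effPotential_le`). If instead `V` is bounded below, so is `V_eff`, because the
kernel is positive with an integral independent of `x`.

In either case the form is coercive: up to a multiple of `‖ψ‖²`, it dominates the kinetic energy and
`∫ |V_eff| |ψ|²` separately (`SchrodingerCoercive`). Semiboundedness is then immediate, and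
closedness follows from Fatou's lemma applied to each energy. The Gaussian moment condition on `V`
gives `V_eff` a continuous majorant, so test functions lie in the form domain, which is therefore
dense.

The self-adjoint operator comes from the representation theorem, proved through the Riesz lemma on
the form domain. -/

lemma im_form_self (q : SesqForm H) (ψ : q.domain) : (q.form ψ ψ).im = 0 := by
  have h := congrArg Complex.im (q.hermitian ψ ψ)
  simp only [Complex.conj_im] at h
  linarith

lemma form_self (q : SesqForm H) (ψ : q.domain) : q.form ψ ψ = (q.quad ψ : ℂ) :=
  Complex.ext rfl (by simpa using q.im_form_self ψ)

/-- A copy of the domain of a form, to carry the form inner product. -/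
def FormDomain (q : SesqForm H) : Type _ := q.domain

instance (q : SesqForm H) : AddCommGroup q.FormDomain := inferInstanceAs (AddCommGroup q.domain)

instance (q : SesqForm H) : Module ℂ q.FormDomain := inferInstanceAs (Module ℂ q.domain)

/-- The inclusion of the form domain into the domain. -/
def FormDomain.val {q : SesqForm H} : q.FormDomain →ₗ[ℂ] q.domain := LinearMap.id

/-- The form inner product `q(φ, ψ) + (1 - c) ⟨φ, ψ⟩` of a form with lower bound `c`. -/
abbrev formCore (q : SesqForm H) (c : ℝ) (hc : ∀ ψ : q.domain, c * ‖(ψ : H)‖ ^ 2 ≤ q.quad ψ) :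
    InnerProductSpace.Core ℂ q.FormDomain where
  inner φ ψ := q.form φ.val ψ.val + ((1 - c : ℝ) : ℂ) * inner ℂ (φ.val : H) (ψ.val : H)
  conj_inner_symm φ ψ := by
    rw [map_add, ← q.hermitian, map_mul, Complex.conj_ofReal, inner_conj_symm]
  re_inner_nonneg ψ := by
    rw [inner_self_eq_norm_sq_to_K, form_self]
    have := hc ψ.val
    have h2 : 0 ≤ ‖(ψ.val : H)‖ ^ 2 := by positivity
    have h3 : 0 ≤ q.quad ψ.val + (1 - c) * ‖(ψ.val : H)‖ ^ 2 := by linarith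
    convert h3
    simp [← Complex.ofReal_pow]
  add_left φ φ' ψ := by
    rw [map_add, LinearMap.map_add₂, Submodule.coe_add, inner_add_left]
    ring
  smul_left φ ψ z := by
    rw [map_smul, LinearMap.map_smulₛₗ₂, Submodule.coe_smul, inner_smul_left, smul_eq_mul]
    ring
  definite ψ h := by
    rw [inner_self_eq_norm_sq_to_K, form_self] at h
    have h1 := hc ψ.val
    have h2 : q.quad ψ.val + (1 - c) * ‖(ψ.val : H)‖ ^ 2 = 0 := by
      simpa [← Complex.ofReal_pow] using congrArg Complex.re h
    have h3 : ‖(ψ.val : H)‖ ^ 2 = 0 := le_antisymm (by linarith) (by positivity)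
    exact Subtype.ext (norm_eq_zero.1 (pow_eq_zero_iff two_ne_zero |>.1 h3))

/-- The shifted operator of a closed semibounded form is onto. -/
lemma exists_forall_form_add_eq_inner [CompleteSpace H] (q : SesqForm H) (hcl : q.Closed) (c : ℝ)
    (hc : ∀ ψ : q.domain, c * ‖(ψ : H)‖ ^ 2 ≤ q.quad ψ) (η : H) :
    ∃ ψ : q.domain, ∀ φ : q.domain,
      q.form φ ψ + ((1 - c : ℝ) : ℂ) * inner ℂ (φ : H) (ψ : H) = inner ℂ (φ : H) η := by
  let core := q.formCore c hc
  let _ : NormedAddCommGroup q.FormDomain := core.toNormedAddCommGroup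
  let _ : InnerProductSpace ℂ q.FormDomain := InnerProductSpace.ofCore core.toCore
  have hinner : ∀ φ ψ : q.FormDomain, inner ℂ φ ψ =
      q.form φ.val ψ.val + ((1 - c : ℝ) : ℂ) * inner ℂ (φ.val : H) (ψ.val : H) :=
    fun _ _ => rfl
  have hnorm : ∀ ψ : q.FormDomain,
      ‖ψ‖ ^ 2 = q.quad ψ.val + (1 - c) * ‖(ψ.val : H)‖ ^ 2 := fun ψ => by
    have h := hinner ψ ψ
    rw [inner_self_eq_norm_sq_to_K, inner_self_eq_norm_sq_to_K, form_self] at h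
    simpa [← Complex.ofReal_pow] using congrArg Complex.re h
  -- Shifting by `1 - c` instead of `-c` makes the form norm dominate the norm of `H`.
  have hle : ∀ ψ : q.FormDomain, ‖(ψ.val : H)‖ ≤ ‖ψ‖ := fun ψ => by
    refine le_of_sq_le_sq ?_ (norm_nonneg _)
    have := hc ψ.val
    rw [hnorm]
    linarith
  -- Closedness of the form is completeness in the form norm.
  have hcomplete : CompleteSpace q.FormDomain := by
    refine Metric.complete_of_cauchySeq_tendsto fun u hu => ?_
    let ι : q.FormDomain →L[ℂ] H :=
      (q.domain.subtype ∘ₗ FormDomain.val).mkContinuous 1 fun ψ => by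
        simpa using hle ψ
    obtain ⟨ψ, hψ⟩ := cauchySeq_tendsto_of_complete (ι.uniformContinuous.comp_cauchySeq hu)
    have hpair : Tendsto (fun p : ℕ × ℕ => ‖u p.1 - u p.2‖) atTop (𝓝 0) := by
      simpa only [dist_eq_norm] using cauchySeq_iff_tendsto_dist_atTop_0.1 hu
    have hpairH : Tendsto (fun p : ℕ × ℕ => ‖((u p.1 - u p.2).val : H)‖) atTop (𝓝 0) :=
      squeeze_zero (fun _ => norm_nonneg _) (fun p => hle _) hpair
    have hq : Tendsto (fun p : ℕ × ℕ => q.quad ((u p.1).val - (u p.2).val)) atTop (𝓝 0) := by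
      have h := (hpair.pow 2).sub ((hpairH.pow 2).const_mul (1 - c))
      simp only [hnorm, add_sub_cancel_right, map_sub] at h
      simpa using h
    obtain ⟨hmem, hlim⟩ := hcl (fun n => (u n).val) ψ hψ hq
    let ψ' : q.FormDomain := (⟨ψ, hmem⟩ : q.domain)
    refine ⟨ψ', tendsto_iff_norm_sub_tendsto_zero.2 ?_⟩
    have h1 : Tendsto (fun n => ‖((u n - ψ').val : H)‖) atTop (𝓝 0) :=
      tendsto_iff_norm_sub_tendsto_zero.1 hψ
    have h2 : Tendsto (fun n => ‖u n - ψ'‖ ^ 2) atTop (𝓝 0) := by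
      simp only [hnorm]
      have hval : ∀ n, (u n - ψ').val = (u n).val - ⟨ψ, hmem⟩ := fun n => rfl
      simpa [hval] using hlim.add ((h1.pow 2).const_mul (1 - c))
    simpa using h2.sqrt
  -- The Riesz vector of `φ ↦ ⟨η, φ⟩` in the form inner product solves the equation.
  let ℓ : StrongDual ℂ q.FormDomain :=
    ((innerₛₗ ℂ η).comp (q.domain.subtype ∘ₗ FormDomain.val)).mkContinuous ‖η‖ fun ψ =>
      (norm_inner_le_norm _ _).trans (mul_le_mul_of_nonneg_left (hle ψ) (norm_nonneg _))
  obtain ⟨ψ, hψ⟩ := (InnerProductSpace.toDual ℂ q.FormDomain).surjective ℓ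
  refine ⟨ψ.val, fun φ => ?_⟩
  let φ' : q.FormDomain := φ
  have h : inner ℂ ψ φ' = inner ℂ η (φ : H) := by
    have := DFunLike.congr_fun hψ φ'
    rwa [InnerProductSpace.toDual_apply_apply] at this
  have h' := congrArg (starRingEnd ℂ) h
  rw [inner_conj_symm, inner_conj_symm] at h'
  exact h'

lemma IsAssociated.unique {q : SesqForm H} {A B : H →ₗ.[ℂ] H} (hA : q.IsAssociated A)
    (hB : q.IsAssociated B) : A = B :=
  LinearPMap.eq_of_eq_graph <| by
    ext ⟨ψ, η⟩
    rw [hA, hB]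

/-- The graph of the operator associated with a form. -/
def associatedGraph (q : SesqForm H) : Submodule ℂ (H × H) where
  carrier := {p | ∃ hψ : p.1 ∈ q.domain, ∀ φ : q.domain,
    q.form φ ⟨p.1, hψ⟩ = inner ℂ (φ : H) p.2}
  zero_mem' := ⟨q.domain.zero_mem, fun φ => by
    rw [Prod.snd_zero, inner_zero_right]
    exact (q.form φ).map_zero⟩
  add_mem' := by
    rintro x y ⟨hx, hx'⟩ ⟨hy, hy'⟩
    refine ⟨q.domain.add_mem hx hy, fun φ => ?_⟩
    rw [Prod.snd_add, inner_add_right, ← hx', ← hy']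
    exact (q.form φ).map_add ⟨x.1, hx⟩ ⟨y.1, hy⟩
  smul_mem' := by
    rintro z x ⟨hx, hx'⟩
    refine ⟨q.domain.smul_mem z hx, fun φ => ?_⟩
    rw [Prod.smul_snd, inner_smul_right, ← hx']
    exact (q.form φ).map_smul z ⟨x.1, hx⟩

/-- If `(0, η)` lies in the associated graph, then `η` is orthogonal to the dense form domain. Hence
the graph is single-valued. -/
lemma exists_isAssociated (q : SesqForm H) (hd : q.DenselyDefined) :
    ∃ A : H →ₗ.[ℂ] H, q.IsAssociated A := by
  refine ⟨q.associatedGraph.toLinearPMap, fun ψ η => ?_⟩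
  rw [Submodule.toLinearPMap_graph_eq]
  · rfl
  · rintro ⟨ψ, η⟩ ⟨hψ, h⟩ (h0 : ψ = 0)
    refine hd.eq_zero_of_inner_right ℂ fun φ hφ => ?_
    have h1 := h ⟨φ, hφ⟩
    have h2 : (⟨ψ, hψ⟩ : q.domain) = 0 := Subtype.ext h0
    simp only [h2, map_zero] at h1
    exact h1.symm

lemma IsAssociated.operatorBoundedBelow {q : SesqForm H} {A : H →ₗ.[ℂ] H}
    (hA : q.IsAssociated A) (hb : q.BoundedBelow) : OperatorBoundedBelow A := by
  obtain ⟨c, hc⟩ := hb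
  refine ⟨c, fun ψ => ?_⟩
  obtain ⟨hψ, h⟩ := (hA _ _).1 (A.mem_graph ψ)
  rw [← h ⟨ψ, hψ⟩]
  exact hc ⟨ψ, hψ⟩

/-- The operator associated with a densely defined, closed form that is bounded from below is
self-adjoint. -/
lemma IsAssociated.isSelfAdjoint [CompleteSpace H] {q : SesqForm H} {A : H →ₗ.[ℂ] H}
    (hA : q.IsAssociated A) (hb : q.BoundedBelow) (hcl : q.Closed) : IsSelfAdjoint A := by
  obtain ⟨c, hc⟩ := hb
  have hsymm : A.IsFormalAdjoint A := fun φ ψ => by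
    obtain ⟨hφ, h1⟩ := (hA _ _).1 (A.mem_graph φ)
    obtain ⟨hψ, h2⟩ := (hA _ _).1 (A.mem_graph ψ)
    have h1' := h1 ⟨ψ, hψ⟩
    have h2' := h2 ⟨φ, hφ⟩
    rw [← inner_conj_symm, ← h1', ← h2', ← q.hermitian]
  have hsurj : ∀ η : H, ∃ ψ : A.domain, A ψ + ((1 - c : ℝ) : ℂ) • (ψ : H) = η := fun η => by
    obtain ⟨ψ, hψ⟩ := q.exists_forall_form_add_eq_inner hcl c hc η
    have hg : ((ψ : H), η - ((1 - c : ℝ) : ℂ) • (ψ : H)) ∈ A.graph := by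
      refine (hA _ _).2 ⟨ψ.2, fun φ => ?_⟩
      rw [inner_sub_right, inner_smul_right, ← hψ φ, add_sub_cancel_right]
    obtain ⟨y, hy1, hy2⟩ := A.mem_graph_iff.1 hg
    refine ⟨y, ?_⟩
    rw [hy2, hy1]
    exact sub_add_cancel _ _
  have hshift : ∀ φ ψ : A.domain, inner ℂ (A φ + ((1 - c : ℝ) : ℂ) • (φ : H)) (ψ : H) =
      inner ℂ (φ : H) (A ψ + ((1 - c : ℝ) : ℂ) • (ψ : H)) := fun φ ψ => by
    rw [inner_add_left, inner_add_right, hsymm, inner_smul_left, inner_smul_right,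
      Complex.conj_ofReal]
  -- With `S = A + (1 - c)` symmetric and onto, take `f ⊥ dom A` and write `f = S g`, `g = S k`.
  -- Then `0 = ⟨f, k⟩ = ⟨g, S k⟩ = ‖g‖²`.
  have hdense : Dense (A.domain : Set H) := by
    rw [Submodule.dense_iff_topologicalClosure_eq_top,
      Submodule.topologicalClosure_eq_top_iff, Submodule.eq_bot_iff]
    intro f hf
    obtain ⟨g, rfl⟩ := hsurj f
    obtain ⟨k, hk⟩ := hsurj (g : H)
    have h := (Submodule.mem_orthogonal' _ _).1 hf k k.2
    rw [hshift, hk, inner_self_eq_zero] at h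
    have : g = 0 := Subtype.ext h
    simp [this]
  rw [LinearPMap.isSelfAdjoint_def]
  refine le_antisymm ?_ (hsymm.le_adjoint hdense)
  refine LinearPMap.le_of_le_graph ?_
  rintro ⟨y, w⟩ hyw
  rw [LinearPMap.adjoint_graph_eq_graph_adjoint hdense, Submodule.mem_adjoint_iff] at hyw
  -- For `(y, w)` in the adjoint graph, solve `S z = w + (1 - c) y` in `dom A`. Then `y - z` is
  -- orthogonal to the range of `S`, which is everything.
  obtain ⟨z, hz⟩ := hsurj (w + ((1 - c : ℝ) : ℂ) • y)
  have hyz : y = z := by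
    refine sub_eq_zero.1 ?_
    obtain ⟨k, hk⟩ := hsurj (y - z)
    have h1 := hyw _ _ (A.mem_graph k)
    simp only at h1
    have h2 := hshift k z
    rw [hz, inner_add_right, inner_smul_right, inner_add_left, inner_smul_left,
      Complex.conj_ofReal] at h2
    have h3 : inner ℂ (A k + ((1 - c : ℝ) : ℂ) • (k : H)) (y - z) = 0 := by
      rw [inner_sub_right, inner_add_left, inner_add_left, inner_smul_left, inner_smul_left,
        Complex.conj_ofReal]
      linear_combination h1 - h2
    rwa [hk, inner_self_eq_zero] at h3
  rw [hyz, add_left_inj] at hz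
  rw [hyz, ← hz]
  exact A.mem_graph z

end SesqForm

/-! ### Weighted `L²` energies of multiplication operators. -/

open scoped ENNReal

variable {d : ℕ}

/-- The energy `∫ |w| |ψ|²` as an extended nonnegative number. -/
def multEnergy (w : Space d → ℝ) (ψ : Space d → ℂ) : ℝ≥0∞ := ∫⁻ x, ‖w x‖ₑ * ‖ψ x‖ₑ ^ 2

lemma multEnergy_congr (w : Space d → ℝ) {φ ψ : Space d → ℂ}
    (h : ∀ᵐ x, ‖φ x‖ = ‖ψ x‖) : multEnergy w φ = multEnergy w ψ := by
  refine lintegral_congr_ae ?_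
  filter_upwards [h] with x hx
  rw [← ofReal_norm (φ x), hx, ofReal_norm]

lemma multEnergy_abs (w : Space d → ℝ) (ψ : Space d → ℂ) :
    multEnergy (fun x => |w x|) ψ = multEnergy w ψ := by
  simp only [multEnergy, Real.enorm_abs]

lemma mem_multDomain_iff {w : Space d → ℝ} (hw : Measurable w) (ψ : L2Space d) :
    ψ ∈ multDomain w ↔ multEnergy w ψ < ∞ := by
  have hmeas : AEStronglyMeasurable (fun x => ((√|w x| : ℝ) : ℂ) * ψ x) volume :=
    (Complex.measurable_ofReal.comp hw.abs.sqrt).aestronglyMeasurable.mul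
      (Lp.aestronglyMeasurable ψ)
  have h : ψ ∈ multDomain w ↔ MemLp (fun x => ((√|w x| : ℝ) : ℂ) * ψ x) 2 volume := Iff.rfl
  rw [h, MemLp, and_iff_right hmeas,
    eLpNorm_lt_top_iff_lintegral_rpow_enorm_lt_top two_ne_zero ENNReal.ofNat_ne_top, multEnergy]
  refine Eq.to_iff (congrArg (· < ∞) (lintegral_congr fun x => ?_))
  rw [ENNReal.toReal_ofNat, ENNReal.rpow_ofNat, enorm_mul, mul_pow]
  congr 1
  rw [← enorm_pow, ← Complex.ofReal_pow, Real.sq_sqrt (abs_nonneg _), ← Real.enorm_abs (w x)]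
  rw [← ofReal_norm, Complex.norm_real, ofReal_norm]

lemma multForm_quad {w : Space d → ℝ} (hw : Measurable w) (ψ : multDomain w) :
    (multForm w hw).quad ψ = ∫ x, w x * ‖ψ.1 x‖ ^ 2 := by
  have h : (multForm w hw).form ψ ψ = ((∫ x, w x * ‖ψ.1 x‖ ^ 2 : ℝ) : ℂ) := by
    rw [← integral_complex_ofReal]
    refine integral_congr_ae (Eventually.of_forall fun x => ?_)
    simp only [RCLike.conj_mul]
    push_cast
    rfl
  exact (congrArg Complex.re h).trans (Complex.ofReal_re _)

lemma integrable_mul_norm_sq {w : Space d → ℝ} (hw : Measurable w) (ψ : multDomain w) :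
    Integrable (fun x => w x * ‖ψ.1 x‖ ^ 2) volume := by
  refine (multDomain_integrable hw ψ ψ).re.congr (Eventually.of_forall fun x => ?_)
  simp only [RCLike.conj_mul]
  change ((w x : ℂ) * ((‖ψ.1 x‖ : ℝ) : ℂ) ^ 2).re = _
  rw [← Complex.ofReal_pow, ← Complex.ofReal_mul, Complex.ofReal_re]

lemma integral_abs_mul_norm_sq {w : Space d → ℝ} (hw : Measurable w) (ψ : multDomain w) :
    ∫ x, |w x| * ‖ψ.1 x‖ ^ 2 = (multEnergy w ψ.1).toReal := by
  rw [integral_eq_lintegral_of_nonneg_ae (Eventually.of_forall fun x => by positivity)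
    (hw.abs.aestronglyMeasurable.fun_mul ((Lp.aestronglyMeasurable ψ.1).norm.fun_pow 2))]
  congr 1
  refine lintegral_congr fun x => ?_
  rw [ENNReal.ofReal_mul (abs_nonneg _), ENNReal.ofReal_pow (norm_nonneg _), ofReal_norm,
    ← Real.norm_eq_abs, ofReal_norm]

lemma abs_multForm_quad_le {w : Space d → ℝ} (hw : Measurable w) (ψ : multDomain w) :
    |(multForm w hw).quad ψ| ≤ (multEnergy w ψ.1).toReal := by
  rw [multForm_quad hw, ← integral_abs_mul_norm_sq hw]
  refine (abs_integral_le_integral_abs).trans (le_of_eq (integral_congr_ae ?_))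
  exact Eventually.of_forall fun x => by
    simp only [abs_mul, abs_of_nonneg (sq_nonneg ‖ψ.1 x‖)]

lemma multForm_quad_of_nonneg {w : Space d → ℝ} (hw : Measurable w) (h0 : ∀ x, 0 ≤ w x)
    (ψ : multDomain w) : (multForm w hw).quad ψ = (multEnergy w ψ.1).toReal := by
  rw [multForm_quad hw, ← integral_abs_mul_norm_sq hw]
  simp only [abs_of_nonneg (h0 _)]

lemma integrable_norm_sq (ψ : L2Space d) : Integrable (fun x => ‖ψ x‖ ^ 2) volume :=
  (memLp_two_iff_integrable_sq_norm (Lp.aestronglyMeasurable ψ)).1 (Lp.memLp ψ)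

lemma integral_norm_sq (ψ : L2Space d) : ∫ x, ‖ψ x‖ ^ 2 = ‖ψ‖ ^ 2 := by
  have h : (inner ℂ ψ ψ : ℂ) = ((∫ x, ‖ψ x‖ ^ 2 : ℝ) : ℂ) := by
    rw [L2.inner_def, ← integral_complex_ofReal]
    refine integral_congr_ae (Eventually.of_forall fun x => ?_)
    simp only [inner_self_eq_norm_sq_to_K]
    push_cast
    rfl
  rw [inner_self_eq_norm_sq_to_K] at h
  have h' := congrArg Complex.re h
  simpa [← Complex.ofReal_pow] using h'.symm

/-- Lower semicontinuity of the energy, in the form that gives closedness of the form. -/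
lemma multEnergy_sub_le_of_tendsto {w : Space d → ℝ} (hw : Measurable w) {u : ℕ → L2Space d}
    {ψ : L2Space d} (hu : Tendsto u atTop (𝓝 ψ)) {ε : ℝ≥0∞} {N : ℕ}
    (hN : ∀ n m, N ≤ n → N ≤ m → multEnergy w (u n - u m : L2Space d) ≤ ε) (n : ℕ) (hn : N ≤ n) :
    multEnergy w (u n - ψ : L2Space d) ≤ ε := by
  obtain ⟨s, hs, hlim⟩ := (tendstoInMeasure_of_tendsto_Lp hu).exists_seq_tendsto_ae
  have hae : ∀ᵐ x, Tendsto (fun k => ‖w x‖ₑ * ‖(u n - u (s k) : L2Space d) x‖ₑ ^ 2) atTop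
      (𝓝 (‖w x‖ₑ * ‖(u n - ψ : L2Space d) x‖ₑ ^ 2)) := by
    filter_upwards [hlim, Lp.coeFn_sub (u n) ψ,
      ae_all_iff.2 fun k => Lp.coeFn_sub (u n) (u (s k))] with x h1 h2 h3
    simp only [h2, h3, Pi.sub_apply]
    refine ENNReal.Tendsto.const_mul ?_ (Or.inr enorm_ne_top)
    exact ((ENNReal.continuous_pow 2).tendsto _).comp
      ((continuous_enorm.tendsto _).comp (tendsto_const_nhds.sub h1))
  -- Fatou's lemma in `k`, with `n` fixed, along the a.e. convergent subsequence.
  calc multEnergy w (u n - ψ : L2Space d)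
      = ∫⁻ x, liminf (fun k => ‖w x‖ₑ * ‖(u n - u (s k) : L2Space d) x‖ₑ ^ 2) atTop :=
        lintegral_congr_ae (hae.mono fun x hx => hx.liminf_eq.symm)
    _ ≤ liminf (fun k => multEnergy w (u n - u (s k) : L2Space d)) atTop :=
        lintegral_liminf_le' fun k =>
          hw.enorm.aemeasurable.mul ((Lp.aestronglyMeasurable _).enorm.pow_const 2)
    _ ≤ ε := by
        refine liminf_le_of_le (by isBoundedDefault) fun b hb => ?_
        obtain ⟨k, hk1, hk2⟩ :=
          (hb.and ((tendsto_atTop.1 hs.tendsto_atTop) N)).exists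
        exact hk1.trans (hN n _ hn hk2)

lemma multEnergy_tendsto_of_cauchy {w : Space d → ℝ} (hw : Measurable w) {u : ℕ → L2Space d}
    {ψ : L2Space d} (hmem : ∀ n, u n ∈ multDomain w) (hu : Tendsto u atTop (𝓝 ψ))
    (hc : Tendsto (fun p : ℕ × ℕ => multEnergy w (u p.1 - u p.2 : L2Space d)) atTop (𝓝 0)) :
    ψ ∈ multDomain w ∧
      Tendsto (fun n => multEnergy w (u n - ψ : L2Space d)) atTop (𝓝 0) := by
  have key : ∀ ε : ℝ≥0∞, 0 < ε → ∃ N, ∀ n, N ≤ n → multEnergy w (u n - ψ : L2Space d) ≤ ε := by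
    intro ε hε
    have h := ENNReal.tendsto_nhds_zero.1 hc ε hε
    obtain ⟨⟨N, M⟩, hNM⟩ := eventually_atTop.1 h
    refine ⟨max N M, multEnergy_sub_le_of_tendsto hw hu fun n m hn hm => ?_⟩
    exact hNM (n, m) ⟨(le_max_left _ _).trans hn, (le_max_right _ _).trans hm⟩
  refine ⟨?_, ENNReal.tendsto_nhds_zero.2 fun ε hε => ?_⟩
  -- Finite energy of a single difference suffices: `ψ = u N - (u N - ψ)`.
  · obtain ⟨N, hN⟩ := key 1 one_pos
    have h : u N - ψ ∈ multDomain w :=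
      (mem_multDomain_iff hw _).2 ((hN N le_rfl).trans_lt ENNReal.one_lt_top)
    simpa using (multDomain w).sub_mem (hmem N) h
  · obtain ⟨N, hN⟩ := key ε hε
    exact eventually_atTop.2 ⟨N, hN⟩

/-! ### Kinetic energy -/

/-- The symbol of `-Δ`. -/
def laplaceSymbol (d : ℕ) (ξ : Space d) : ℝ := (2 * Real.pi * ‖ξ‖) ^ 2

lemma measurable_laplaceSymbol (d : ℕ) : Measurable (laplaceSymbol d) :=
  (measurable_norm.const_mul _).pow_const 2

/-- The kinetic energy `‖(-Δ)^{1/2} ψ‖²` as an extended nonnegative number. -/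
def kineticEnergy (ψ : L2Space d) : ℝ≥0∞ :=
  multEnergy (laplaceSymbol d) (Lp.fourierTransformₗᵢ (Space d) ℂ ψ)

lemma mem_negLaplacianForm_domain_iff (ψ : L2Space d) :
    ψ ∈ (negLaplacianForm d).domain ↔ kineticEnergy ψ < ∞ :=
  mem_multDomain_iff (measurable_laplaceSymbol d) _

lemma negLaplacianForm_quad (ψ : (negLaplacianForm d).domain) :
    (negLaplacianForm d).quad ψ = (kineticEnergy (ψ : L2Space d)).toReal :=
  multForm_quad_of_nonneg (measurable_laplaceSymbol d) (fun _ => sq_nonneg _)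
    ⟨Lp.fourierTransformₗᵢ (Space d) ℂ ψ, ψ.2⟩

lemma kineticEnergy_tendsto_of_cauchy {u : ℕ → L2Space d} {ψ : L2Space d}
    (hmem : ∀ n, u n ∈ (negLaplacianForm d).domain) (hu : Tendsto u atTop (𝓝 ψ))
    (hc : Tendsto (fun p : ℕ × ℕ => kineticEnergy (u p.1 - u p.2)) atTop (𝓝 0)) :
    ψ ∈ (negLaplacianForm d).domain ∧
      Tendsto (fun n => kineticEnergy (u n - ψ)) atTop (𝓝 0) := by
  have h := multEnergy_tendsto_of_cauchy (measurable_laplaceSymbol d)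
    (u := fun n => Lp.fourierTransformₗᵢ (Space d) ℂ (u n))
    (ψ := Lp.fourierTransformₗᵢ (Space d) ℂ ψ) hmem
    (((Lp.fourierTransformₗᵢ (Space d) ℂ).continuous.tendsto _).comp hu)
    (by simpa only [kineticEnergy, map_sub] using hc)
  refine ⟨h.1, ?_⟩
  simpa only [kineticEnergy, map_sub] using h.2

/-- The Fourier transform `g` is again Schwartz: one factor of `‖g‖ ^ 2` is bounded and the other
has an integrable second moment. -/
lemma SchwartzMap.toLp_mem_negLaplacianForm_domain (f : SchwartzMap (Space d) ℂ) :
    f.toLp 2 volume ∈ (negLaplacianForm d).domain := by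
  rw [mem_negLaplacianForm_domain_iff, kineticEnergy]
  have h1 : Lp.fourierTransformₗᵢ (Space d) ℂ (f.toLp 2) = (FourierTransform.fourier f).toLp 2 :=
    f.toLp_fourier_eq
  rw [h1]
  set g := FourierTransform.fourier f
  have h2 : ∀ᵐ x, ‖(g.toLp 2 volume : L2Space d) x‖ = ‖g x‖ := by
    filter_upwards [SchwartzMap.coeFn_toLp g 2 volume] with x hx
    rw [hx]
  rw [multEnergy_congr _ h2]
  obtain ⟨C, hC⟩ : ∃ C : ℝ, ∀ x, ‖g x‖ ≤ C := ⟨_, fun x => g.norm_le_seminorm ℝ x⟩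
  have hint : Integrable (fun x => laplaceSymbol d x * ‖g x‖ ^ 2) volume := by
    refine ((g.integrable_pow_mul volume 2).const_mul ((2 * Real.pi) ^ 2 * C)).mono' ?_
      (Eventually.of_forall fun x => ?_)
    · exact (measurable_laplaceSymbol d).aestronglyMeasurable.mul
        (g.continuous.norm.pow 2).aestronglyMeasurable
    · rw [laplaceSymbol, Real.norm_of_nonneg (mul_nonneg (sq_nonneg _) (sq_nonneg _))]
      calc (2 * Real.pi * ‖x‖) ^ 2 * ‖g x‖ ^ 2
          = (2 * Real.pi) ^ 2 * ‖x‖ ^ 2 * ‖g x‖ * ‖g x‖ := by ring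
        _ ≤ (2 * Real.pi) ^ 2 * ‖x‖ ^ 2 * ‖g x‖ * C := by gcongr; exact hC x
        _ = _ := by ring
  have hfin := hint.2
  rw [hasFiniteIntegral_iff_enorm] at hfin
  simpa only [multEnergy, enorm_mul, enorm_pow, enorm_norm] using hfin

/-! ### Translations -/

/-- Translation of an `L²` function. -/
def l2Translate (z : Space d) : L2Space d →ₗᵢ[ℂ] L2Space d :=
  Lp.compMeasurePreservingₗᵢ ℂ (· + z) (measurePreserving_add_right volume z)

lemma coeFn_l2Translate (z : Space d) (ψ : L2Space d) :
    l2Translate z ψ =ᵐ[volume] fun x => ψ (x + z) :=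
  Lp.coeFn_compMeasurePreserving ψ (measurePreserving_add_right volume z)

lemma translate_toLp (z : Space d) (f : SchwartzMap (Space d) ℂ) :
    l2Translate z (f.toLp 2) = (f.compSubConstCLM ℂ (-z)).toLp 2 := by
  refine Lp.ext ?_
  filter_upwards [coeFn_l2Translate z (f.toLp 2), (f.compSubConstCLM ℂ (-z)).coeFn_toLp 2,
    (measurePreserving_add_right volume z).quasiMeasurePreserving.ae_eq_comp
      (f.coeFn_toLp 2 volume)] with x h1 h2 h3
  rw [Function.comp_apply, Function.comp_apply] at h3
  rw [h1, h2, h3, SchwartzMap.compSubConstCLM_apply, sub_neg_eq_add]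

lemma norm_fourier_compSubConstCLM (z : Space d) (f : SchwartzMap (Space d) ℂ) (ξ : Space d) :
    ‖FourierTransform.fourier (f.compSubConstCLM ℂ (-z)) ξ‖ =
      ‖FourierTransform.fourier f ξ‖ := by
  have hcoe : (f.compSubConstCLM ℂ (-z) : Space d → ℂ) = f ∘ fun x => x + z := by
    ext x
    simp [SchwartzMap.compSubConstCLM_apply]
  rw [SchwartzMap.fourier_coe, SchwartzMap.fourier_coe, hcoe]
  have h := congrFun (VectorFourier.fourierIntegral_comp_add_right Real.fourierChar volume
    (innerₗ (Space d)) (f : Space d → ℂ) z) ξ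
  exact (congrArg norm h).trans (Circle.norm_smul _ _)

/-- On Schwartz functions the two transforms differ by a unimodular character. Composing with the
1-Lipschitz norm turns the a.e. identity into an equality of continuous maps into `L²`, so it
extends by density. -/
lemma norm_fourierTransform_translate (z : Space d) (ψ : L2Space d) :
    ∀ᵐ ξ, ‖Lp.fourierTransformₗᵢ (Space d) ℂ (l2Translate z ψ) ξ‖ =
      ‖Lp.fourierTransformₗᵢ (Space d) ℂ ψ ξ‖ := by
  have hnorm : LipschitzWith 1 (norm : ℂ → ℝ) := lipschitzWith_one_norm
  have h : hnorm.compLp norm_zero (Lp.fourierTransformₗᵢ (Space d) ℂ (l2Translate z ψ)) =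
      hnorm.compLp norm_zero (Lp.fourierTransformₗᵢ (Space d) ℂ ψ) := by
    refine DenseRange.induction_on
      (p := fun ψ => hnorm.compLp norm_zero (Lp.fourierTransformₗᵢ (Space d) ℂ (l2Translate z ψ)) =
        hnorm.compLp norm_zero (Lp.fourierTransformₗᵢ (Space d) ℂ ψ))
      (SchwartzMap.denseRange_toLpCLM (p := 2) ENNReal.ofNat_ne_top) ψ ?_ fun f => ?_
    · refine isClosed_eq ?_ ?_
      · exact (hnorm.continuous_compLp norm_zero).comp
          ((Lp.fourierTransformₗᵢ (Space d) ℂ).continuous.comp (l2Translate z).continuous)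
      · exact (hnorm.continuous_compLp norm_zero).comp
          (Lp.fourierTransformₗᵢ (Space d) ℂ).continuous
    · rw [SchwartzMap.toLpCLM_apply, translate_toLp]
      have h1 : ∀ g : SchwartzMap (Space d) ℂ, Lp.fourierTransformₗᵢ (Space d) ℂ (g.toLp 2) =
        (FourierTransform.fourier g).toLp 2 := fun g => g.toLp_fourier_eq
      rw [h1, h1]
      refine Lp.ext ?_
      filter_upwards [hnorm.coeFn_compLp norm_zero
          ((FourierTransform.fourier (f.compSubConstCLM ℂ (-z))).toLp 2 : L2Space d),
        hnorm.coeFn_compLp norm_zero ((FourierTransform.fourier f).toLp 2 : L2Space d),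
        (FourierTransform.fourier (f.compSubConstCLM ℂ (-z))).coeFn_toLp 2,
        (FourierTransform.fourier f).coeFn_toLp 2] with ξ h2 h3 h4 h5
      rw [h2, h3, Function.comp_apply, Function.comp_apply, h4, h5,
        norm_fourier_compSubConstCLM]
  filter_upwards [hnorm.coeFn_compLp norm_zero
      (Lp.fourierTransformₗᵢ (Space d) ℂ (l2Translate z ψ)),
    hnorm.coeFn_compLp norm_zero (Lp.fourierTransformₗᵢ (Space d) ℂ ψ)] with ξ h1 h2
  rw [h] at h1
  exact h1.symm.trans h2

lemma kineticEnergy_translate (z : Space d) (ψ : L2Space d) :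
    kineticEnergy (l2Translate z ψ) = kineticEnergy ψ :=
  multEnergy_congr _ (norm_fourierTransform_translate z ψ)

/-- Moves the translation from the wave function to the weight, where averaging over `z` becomes a
convolution. -/
lemma multEnergy_translate (w : Space d → ℝ) (z : Space d) (ψ : L2Space d) :
    multEnergy w (l2Translate z ψ) = ∫⁻ x, ‖w (x - z)‖ₑ * ‖ψ x‖ₑ ^ 2 := by
  have h : ∀ᵐ x, ‖l2Translate z ψ x‖ = ‖ψ (x + z)‖ :=
    (coeFn_l2Translate z ψ).mono fun x hx => congrArg norm hx
  rw [multEnergy_congr w h, multEnergy,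
    ← lintegral_add_right_eq_self (fun x => ‖w (x - z)‖ₑ * ‖ψ x‖ₑ ^ 2) z]
  simp only [add_sub_cancel_right]


/-! ### The smeared potential -/

lemma smearingConst_pos (hd : 2 ≤ d) {hbar m q ε₀ : ℝ} (h_hbar : 0 < hbar) (hm : 0 < m)
    (hq : q ≠ 0) (hε₀ : 0 < ε₀) {ω ρ : Space d → ℝ} (hω : ∀ k, 0 ≤ ω k)
    (hρ : MemLp (fun k => ρ k / ω k ^ (3 / 2 : ℝ)) 2 volume)
    (hρ_ne : ¬ (fun k => ρ k / ω k ^ (3 / 2 : ℝ)) =ᵐ[volume] 0) :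
    0 < smearingConst d hbar m q ε₀ ω ρ := by
  -- This also holds where `ω k = 0`: division by zero makes both sides `0`.
  have hsq : ∀ k, (ρ k / ω k ^ (3 / 2 : ℝ)) ^ 2 = |ρ k| ^ 2 / ω k ^ 3 := fun k => by
    rw [div_pow, sq_abs, ← Real.rpow_mul_natCast (hω k)]
    norm_num
  have hint : Integrable (fun k => |ρ k| ^ 2 / ω k ^ 3) volume := by
    simpa only [hsq] using hρ.integrable_sq
  have hnonneg : ∀ k, 0 ≤ |ρ k| ^ 2 / ω k ^ 3 := fun k => by
    rw [← hsq]
    exact sq_nonneg _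
  have hpos : 0 < ∫ k, |ρ k| ^ 2 / ω k ^ 3 := by
    refine lt_of_le_of_ne (integral_nonneg hnonneg) fun h0 => hρ_ne ?_
    have h := (integral_eq_zero_iff_of_nonneg hnonneg hint).1 h0.symm
    filter_upwards [h] with k hk
    rw [← hsq] at hk
    exact pow_eq_zero_iff two_ne_zero |>.1 hk
  have hd' : (2 : ℝ) ≤ d := by exact_mod_cast hd
  have hd1 : 0 < (d : ℝ) - 1 := by linarith
  unfold smearingConst
  positivity

/-- From `‖y‖² ≤ 2‖x‖² + 2‖x - y‖²`. Separating `x` from `y` costs half the Gaussian rate, so the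
moment condition is used at `t = 1 / (8 * a)`. -/
lemma exp_neg_norm_sub_sq_le {a : ℝ} (ha : 0 < a) (x y : Space d) :
    Real.exp (-‖x - y‖ ^ 2 / (4 * a)) ≤
      Real.exp (‖x‖ ^ 2 / (4 * a)) * Real.exp (-(1 / (8 * a)) * ‖y‖ ^ 2) := by
  rw [← Real.exp_add, Real.exp_le_exp]
  have h1 : ‖y‖ ≤ ‖x‖ + ‖x - y‖ := by
    have := norm_sub_le x (x - y)
    rwa [sub_sub_cancel] at this
  have h2 : ‖y‖ ^ 2 ≤ 2 * ‖x‖ ^ 2 + 2 * ‖x - y‖ ^ 2 := by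
    nlinarith [sq_nonneg (‖x‖ - ‖x - y‖), norm_nonneg y]
  have h3 : ‖x‖ ^ 2 / (4 * a) + -(1 / (8 * a)) * ‖y‖ ^ 2 - -‖x - y‖ ^ 2 / (4 * a) =
      (2 * ‖x‖ ^ 2 + 2 * ‖x - y‖ ^ 2 - ‖y‖ ^ 2) / (8 * a) := by
    field_simp
    ring
  have h4 : 0 ≤ (2 * ‖x‖ ^ 2 + 2 * ‖x - y‖ ^ 2 - ‖y‖ ^ 2) / (8 * a) :=
    div_nonneg (by linarith) (by linarith)
  linarith

lemma abs_mul_exp_le {a : ℝ} (ha : 0 < a) (V : Space d → ℝ) (x y : Space d) :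
    |V y * Real.exp (-‖x - y‖ ^ 2 / (4 * a))| ≤
      Real.exp (‖x‖ ^ 2 / (4 * a)) * (|V y| * Real.exp (-(1 / (8 * a)) * ‖y‖ ^ 2)) := by
  rw [abs_mul, Real.abs_exp, mul_left_comm]
  exact mul_le_mul_of_nonneg_left (exp_neg_norm_sub_sq_le ha x y) (abs_nonneg _)

lemma integrable_mul_exp_neg_norm_sub_sq {a : ℝ} (ha : 0 < a) {V : Space d → ℝ}
    (hV : Measurable V)
    (hV2 : ∀ t : ℝ, 0 < t → Integrable (fun x => |V x| * Real.exp (-t * ‖x‖ ^ 2)) volume)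
    (x : Space d) :
    Integrable (fun y => V y * Real.exp (-‖x - y‖ ^ 2 / (4 * a))) volume := by
  refine ((hV2 (1 / (8 * a)) (by positivity)).const_mul (Real.exp (‖x‖ ^ 2 / (4 * a)))).mono' ?_
    (Eventually.of_forall fun y => (Real.norm_eq_abs _).trans_le (abs_mul_exp_le ha V x y))
  exact (hV.mul (by fun_prop)).aestronglyMeasurable

/-- The growth of the bound is harmless: only its continuity is needed, to make `V_eff` bounded on
compact sets. -/
lemma abs_effPotential_le {a : ℝ} (ha : 0 < a) {V : Space d → ℝ}
    (hV2 : ∀ t : ℝ, 0 < t → Integrable (fun x => |V x| * Real.exp (-t * ‖x‖ ^ 2)) volume) :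
    ∃ C : ℝ, 0 ≤ C ∧ ∀ x, |effPotential a V x| ≤ C * Real.exp (‖x‖ ^ 2 / (4 * a)) := by
  have hA : 0 ≤ 1 / (4 * Real.pi * a) ^ ((d : ℝ) / 2) := by positivity
  refine ⟨1 / (4 * Real.pi * a) ^ ((d : ℝ) / 2) *
    ∫ y, |V y| * Real.exp (-(1 / (8 * a)) * ‖y‖ ^ 2),
    mul_nonneg hA (integral_nonneg fun y => by positivity), fun x => ?_⟩
  rw [effPotential, abs_mul, abs_of_nonneg hA,
    mul_assoc (1 / (4 * Real.pi * a) ^ ((d : ℝ) / 2))]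
  refine mul_le_mul_of_nonneg_left ?_ hA
  rw [mul_comm (∫ y, _), ← integral_const_mul]
  exact norm_integral_le_of_norm_le
    ((hV2 (1 / (8 * a)) (by positivity)).const_mul (Real.exp (‖x‖ ^ 2 / (4 * a))))
    (Eventually.of_forall fun y => (Real.norm_eq_abs _).trans_le (abs_mul_exp_le ha V x y))

lemma integrable_exp_neg_norm_sq {a : ℝ} (ha : 0 < a) :
    Integrable (fun z : Space d => Real.exp (-‖z‖ ^ 2 / (4 * a))) volume := by
  have hb : 0 < ((1 / (4 * a) : ℝ) : ℂ).re := by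
    rw [Complex.ofReal_re]
    positivity
  have h := (GaussianFourier.integrable_cexp_neg_mul_sq_norm_add hb 0 (0 : Space d)).norm
  refine h.congr (Eventually.of_forall fun z => ?_)
  simp only [zero_mul, add_zero, Complex.norm_exp]
  congr 1
  rw [← Complex.ofReal_pow, ← Complex.ofReal_neg, ← Complex.ofReal_mul, Complex.ofReal_re]
  ring

lemma effPotential_bounded_below {a : ℝ} (ha : 0 < a) {V : Space d → ℝ} (hV : Measurable V)
    (hV2 : ∀ t : ℝ, 0 < t → Integrable (fun x => |V x| * Real.exp (-t * ‖x‖ ^ 2)) volume)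
    {c : ℝ} (hc : ∀ x, c ≤ V x) :
    ∃ C : ℝ, 0 ≤ C ∧ ∀ x, -C ≤ effPotential a V x := by
  have hA : 0 ≤ 1 / (4 * Real.pi * a) ^ ((d : ℝ) / 2) := by positivity
  set A := 1 / (4 * Real.pi * a) ^ ((d : ℝ) / 2) with hAdef
  refine ⟨A * (|c| * ∫ z : Space d, Real.exp (-‖z‖ ^ 2 / (4 * a))),
    mul_nonneg hA (mul_nonneg (abs_nonneg _) (integral_nonneg fun y => by positivity)),
    fun x => ?_⟩
  rw [effPotential, ← hAdef, ← mul_neg]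
  refine mul_le_mul_of_nonneg_left ?_ hA
  rw [← integral_sub_left_eq_self (fun z : Space d => Real.exp (-‖z‖ ^ 2 / (4 * a))) volume x,
    ← neg_mul, ← integral_const_mul]
  refine integral_mono (((integrable_exp_neg_norm_sq ha).comp_sub_left x).const_mul _)
    (integrable_mul_exp_neg_norm_sub_sq ha hV hV2 x) fun y => ?_
  exact mul_le_mul_of_nonneg_right ((neg_abs_le c).trans (hc y)) (Real.exp_nonneg _)

/-- Gaussian smearing averages the energy over translations of the wave function. -/
lemma multEnergy_effPotential_le (a : ℝ) {V : Space d → ℝ} (hV : Measurable V) {ψ : L2Space d}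
    {M : ℝ≥0∞} (hM : ∀ z, multEnergy V (l2Translate z ψ) ≤ M) :
    multEnergy (effPotential a V) ψ ≤
      ‖1 / (4 * Real.pi * a) ^ ((d : ℝ) / 2)‖ₑ *
        (∫⁻ z : Space d, ‖Real.exp (-‖z‖ ^ 2 / (4 * a))‖ₑ) * M := by
  set A := 1 / (4 * Real.pi * a) ^ ((d : ℝ) / 2) with hA
  set G : Space d → ℝ := fun z => Real.exp (-‖z‖ ^ 2 / (4 * a)) with hG
  have hGm : Measurable G := by fun_prop
  -- The substitution `y = x - z` exhibits the potential as an average of translates of `V`.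
  have hpt : ∀ x, ‖effPotential a V x‖ₑ ≤ ‖A‖ₑ * ∫⁻ z, ‖G z‖ₑ * ‖V (x - z)‖ₑ := fun x => by
    rw [effPotential, ← hA, enorm_mul]
    gcongr
    refine (enorm_integral_le_lintegral_enorm _).trans (le_of_eq ?_)
    rw [← lintegral_sub_left_eq_self
      (fun y => ‖V y * Real.exp (-‖x - y‖ ^ 2 / (4 * a))‖ₑ) x]
    refine lintegral_congr fun z => ?_
    rw [sub_sub_cancel, enorm_mul, mul_comm]
  have hψ : AEMeasurable (fun x => ‖ψ x‖ₑ ^ 2) volume :=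
    (Lp.aestronglyMeasurable ψ).enorm.pow_const 2
  have hprod : AEMeasurable (Function.uncurry fun x z : Space d =>
      ‖G z‖ₑ * ‖V (x - z)‖ₑ * ‖ψ x‖ₑ ^ 2) (volume.prod volume) := by
    refine AEMeasurable.mul ?_ hψ.comp_fst
    exact ((hGm.comp measurable_snd).enorm.mul
      (hV.comp (measurable_fst.sub measurable_snd)).enorm).aemeasurable
  calc multEnergy (effPotential a V) ψ
      ≤ ∫⁻ x, ‖A‖ₑ * ∫⁻ z, ‖G z‖ₑ * ‖V (x - z)‖ₑ * ‖ψ x‖ₑ ^ 2 := by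
        refine lintegral_mono fun x => ?_
        rw [lintegral_mul_const' _ _ (by finiteness), ← mul_assoc]
        gcongr
        exact hpt x
    -- Tonelli: the inner integral over `x` is now the energy of a translate of `ψ`.
    _ = ‖A‖ₑ * ∫⁻ z, ‖G z‖ₑ * multEnergy V (l2Translate z ψ) := by
        rw [lintegral_const_mul' _ _ enorm_ne_top, lintegral_lintegral_swap hprod]
        congr 1
        refine lintegral_congr fun z => ?_
        rw [multEnergy_translate, ← lintegral_const_mul' _ _ enorm_ne_top]
        simp only [mul_assoc]
    _ ≤ ‖A‖ₑ * ∫⁻ z, ‖G z‖ₑ * M := by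
        gcongr with z
        exact hM z
    _ = _ := by rw [lintegral_mul_const _ hGm.enorm, mul_assoc]

/-! ### Infinitesimal form-boundedness -/

/-- In `ℝ≥0∞` the inequality itself forces the potential energy to be finite, so the inclusion of
domains needs no separate clause. -/
lemma absInfinitesimallyFormBounded_iff {V : Space d → ℝ} (hV : Measurable V) :
    AbsInfinitesimallyFormBounded V hV ↔ ∀ α : ℝ, 0 < α → ∃ β : ℝ, 0 ≤ β ∧
      ∀ ψ : L2Space d, kineticEnergy ψ < ∞ →
        multEnergy V ψ ≤ ENNReal.ofReal (α * (kineticEnergy ψ).toReal + β * ‖ψ‖ ^ 2) := by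
  have hquad : ∀ ψ : multDomain (fun x => |V x|),
      |(multForm (fun x => |V x|) hV.abs).quad ψ| = (multEnergy V ψ.1).toReal := fun ψ => by
    rw [multForm_quad_of_nonneg hV.abs (fun _ => abs_nonneg _), multEnergy_abs,
      abs_of_nonneg ENNReal.toReal_nonneg]
  constructor
  · rintro ⟨hdom, h⟩ α hα
    obtain ⟨β, hβ, hb⟩ := h α hα
    refine ⟨β, hβ, fun ψ hψ => ?_⟩
    have hψ' := (mem_negLaplacianForm_domain_iff ψ).2 hψ
    have hfin : multEnergy V ψ < ∞ := by
      rw [← multEnergy_abs]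
      exact (mem_multDomain_iff hV.abs ψ).1 (hdom hψ')
    have := hb ⟨ψ, hψ'⟩
    rw [negLaplacianForm_quad] at this
    exact (ENNReal.le_ofReal_iff_toReal_le hfin.ne (by positivity)).2
      ((hquad ⟨ψ, hdom hψ'⟩).symm.trans_le this)
  · intro h
    have hdom : (negLaplacianForm d).domain ≤ multDomain (fun x => |V x|) := fun ψ hψ => by
      obtain ⟨β, -, hb⟩ := h 1 one_pos
      rw [mem_multDomain_iff hV.abs, multEnergy_abs]
      exact (hb ψ ((mem_negLaplacianForm_domain_iff ψ).1 hψ)).trans_lt ENNReal.ofReal_lt_top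
    refine ⟨hdom, fun α hα => ?_⟩
    obtain ⟨β, hβ, hb⟩ := h α hα
    refine ⟨β, hβ, fun ψ => ?_⟩
    rw [negLaplacianForm_quad]
    exact (hquad ⟨ψ, hdom ψ.2⟩).trans_le (ENNReal.toReal_le_of_le_ofReal (by positivity)
      (hb ψ ((mem_negLaplacianForm_domain_iff _).1 ψ.2)))

lemma AbsInfinitesimallyFormBounded.effPotential {a : ℝ} (ha : 0 < a) {V : Space d → ℝ}
    {hV : Measurable V} (h : AbsInfinitesimallyFormBounded V hV) :
    AbsInfinitesimallyFormBounded (effPotential a V) (measurable_effPotential a hV) := by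
  rw [absInfinitesimallyFormBounded_iff] at h ⊢
  have hint : ∫⁻ z : Space d, ‖Real.exp (-‖z‖ ^ 2 / (4 * a))‖ₑ < ∞ :=
    (integrable_exp_neg_norm_sq ha).2
  set K : ℝ≥0∞ := ‖1 / (4 * Real.pi * a) ^ ((d : ℝ) / 2)‖ₑ *
        (∫⁻ z : Space d, ‖Real.exp (-‖z‖ ^ 2 / (4 * a))‖ₑ) with hK
  have hKfin : K < ∞ := ENNReal.mul_lt_top enorm_lt_top hint
  intro α hα
  have hk : 0 ≤ K.toReal := ENNReal.toReal_nonneg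
  -- The total mass `K` of the kernel is not evaluated, only known to be finite. Dividing by `K + 1`
  -- avoids the question whether it vanishes.
  obtain ⟨β, hβ, hb⟩ := h (α / (K.toReal + 1)) (by positivity)
  refine ⟨K.toReal * β, by positivity, fun ψ hψ => ?_⟩
  have h1 := multEnergy_effPotential_le a hV (ψ := ψ) fun z => by
    have h2 := hb (l2Translate z ψ) (by rwa [kineticEnergy_translate])
    rwa [kineticEnergy_translate, LinearIsometry.norm_map] at h2
  refine h1.trans ?_
  rw [← hK]
  nth_rw 1 [← ENNReal.ofReal_toReal hKfin.ne]
  rw [← ENNReal.ofReal_mul hk]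
  refine ENNReal.ofReal_le_ofReal ?_
  have h3 : K.toReal * (α / (K.toReal + 1)) ≤ α := by
    rw [← mul_div_assoc, div_le_iff₀ (by positivity)]
    nlinarith
  have h4 : 0 ≤ (kineticEnergy ψ).toReal := ENNReal.toReal_nonneg
  calc _ = K.toReal * (α / (K.toReal + 1)) * (kineticEnergy ψ).toReal
        + K.toReal * β * ‖ψ‖ ^ 2 := by ring
    _ ≤ _ := by gcongr

/-! ### The form sum -/

/-- The form of the Schrödinger operator `-κ Δ + W`. -/
def schrodingerForm (κ : ℝ) {W : Space d → ℝ} (hW : Measurable W) : SesqForm (L2Space d) :=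
  ((negLaplacianForm d).smul κ).add (multForm W hW)

lemma SesqForm.add_quad {H : Type*} [NormedAddCommGroup H] [InnerProductSpace ℂ H]
    (q₁ q₂ : SesqForm H) (ψ : (q₁.add q₂).domain) :
    (q₁.add q₂).quad ψ = q₁.quad ⟨ψ, ψ.2.1⟩ + q₂.quad ⟨ψ, ψ.2.2⟩ :=
  Complex.add_re _ _

lemma SesqForm.smul_quad {H : Type*} [NormedAddCommGroup H] [InnerProductSpace ℂ H]
    (c : ℝ) (q : SesqForm H) (ψ : q.domain) : (q.smul c).quad ψ = c * q.quad ψ :=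
  Complex.re_ofReal_mul _ _

lemma mem_negLaplacian_of_mem_schrodinger {κ : ℝ} {W : Space d → ℝ} {hW : Measurable W}
    (ψ : (schrodingerForm κ hW).domain) : (ψ : L2Space d) ∈ (negLaplacianForm d).domain :=
  (Submodule.mem_inf.1 ψ.2).1

lemma mem_multDomain_of_mem_schrodinger {κ : ℝ} {W : Space d → ℝ} {hW : Measurable W}
    (ψ : (schrodingerForm κ hW).domain) : (ψ : L2Space d) ∈ multDomain W :=
  (Submodule.mem_inf.1 ψ.2).2

lemma schrodingerForm_quad (κ : ℝ) {W : Space d → ℝ} (hW : Measurable W)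
    (ψ : (schrodingerForm κ hW).domain) :
    (schrodingerForm κ hW).quad ψ = κ * (kineticEnergy (ψ : L2Space d)).toReal +
      (multForm W hW).quad (⟨ψ.1, mem_multDomain_of_mem_schrodinger ψ⟩ : multDomain W) := by
  have h1 := negLaplacianForm_quad ⟨ψ.1, mem_negLaplacian_of_mem_schrodinger ψ⟩
  have h2 := SesqForm.smul_quad κ (negLaplacianForm d)
    ⟨ψ.1, mem_negLaplacian_of_mem_schrodinger ψ⟩
  rw [h1] at h2
  rw [← h2]
  exact SesqForm.add_quad _ _ _

lemma kineticEnergy_lt_top_of_mem_schrodinger {κ : ℝ} {W : Space d → ℝ} {hW : Measurable W}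
    (ψ : (schrodingerForm κ hW).domain) : kineticEnergy (ψ : L2Space d) < ∞ :=
  (mem_negLaplacianForm_domain_iff _).1 (mem_negLaplacian_of_mem_schrodinger ψ)

lemma multEnergy_lt_top_of_mem_schrodinger {κ : ℝ} {W : Space d → ℝ} {hW : Measurable W}
    (ψ : (schrodingerForm κ hW).domain) : multEnergy W (ψ : L2Space d) < ∞ :=
  (mem_multDomain_iff hW _).1 (mem_multDomain_of_mem_schrodinger ψ)

/-- Coercivity of a Schrödinger form: it controls the kinetic and the potential energy. -/
def SchrodingerCoercive (κ : ℝ) {W : Space d → ℝ} (hW : Measurable W) : Prop :=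
  ∃ C β : ℝ, 0 < C ∧ ∀ ψ : (schrodingerForm κ hW).domain,
    κ * (kineticEnergy (ψ : L2Space d)).toReal + (multEnergy W (ψ : L2Space d)).toReal ≤
      C * (schrodingerForm κ hW).quad ψ + β * ‖(ψ : L2Space d)‖ ^ 2

lemma schrodingerCoercive_of_formBounded {κ : ℝ} (hκ : 0 < κ) {W : Space d → ℝ}
    {hW : Measurable W} (h : AbsInfinitesimallyFormBounded W hW) : SchrodingerCoercive κ hW := by
  obtain ⟨β, hβ, hb⟩ := (absInfinitesimallyFormBounded_iff hW).1 h (κ / 2) (by positivity)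
  -- Let `T` be `κ` times the kinetic energy and `P` the energy of `|W|`. From `P ≤ T/2 + β‖ψ‖²`
  -- follows `4P ≤ 2T + 4β‖ψ‖²`, that is `T + P ≤ 3(T - P) + 4β‖ψ‖²`, and the form is at least `T -
  -- P`.
  refine ⟨3, 4 * β, by norm_num, fun ψ => ?_⟩
  have h1 := ENNReal.toReal_le_of_le_ofReal (by positivity)
    (hb ψ (kineticEnergy_lt_top_of_mem_schrodinger ψ))
  have h2 := abs_le.1 (abs_multForm_quad_le hW ⟨ψ.1, mem_multDomain_of_mem_schrodinger ψ⟩)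
  rw [schrodingerForm_quad]
  dsimp only at h2
  linarith [h2.1]

lemma schrodingerCoercive_of_bounded_below (κ : ℝ) {W : Space d → ℝ} {hW : Measurable W}
    {c : ℝ} (hc0 : 0 ≤ c) (hc : ∀ x, -c ≤ W x) : SchrodingerCoercive κ hW := by
  -- The constant comes from the pointwise bound `|W| ≤ W + 2c`, valid when `W ≥ -c`.
  refine ⟨1, 2 * c, one_pos, fun ψ => ?_⟩
  let ψ' : multDomain W := ⟨ψ.1, mem_multDomain_of_mem_schrodinger ψ⟩
  have h : (multEnergy W ψ'.1).toReal ≤ (multForm W hW).quad ψ' + 2 * c * ‖ψ'.1‖ ^ 2 := by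
    have hint := integrable_mul_norm_sq hW ψ'
    have hint2 := (integrable_norm_sq ψ'.1).const_mul (2 * c)
    rw [← integral_abs_mul_norm_sq hW, multForm_quad, ← integral_norm_sq, ← integral_const_mul,
      ← integral_add hint hint2]
    refine integral_mono_of_nonneg (Eventually.of_forall fun x => by positivity)
      (hint.add hint2) (Eventually.of_forall fun x => ?_)
    have h1 : |W x| ≤ W x + 2 * c := abs_le.2 ⟨by linarith [hc x], by linarith⟩
    calc |W x| * ‖ψ'.1 x‖ ^ 2 ≤ (W x + 2 * c) * ‖ψ'.1 x‖ ^ 2 := by gcongr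
      _ = _ := add_mul _ _ _
  rw [schrodingerForm_quad, one_mul, add_assoc]
  exact add_le_add_right h _

lemma SchrodingerCoercive.boundedBelow {κ : ℝ} (hκ : 0 < κ) {W : Space d → ℝ}
    {hW : Measurable W} (h : SchrodingerCoercive κ hW) :
    (schrodingerForm κ hW).BoundedBelow := by
  obtain ⟨C, β, hC, hb⟩ := h
  refine ⟨-(β / C), fun ψ => ?_⟩
  have h1 : 0 ≤ C * (schrodingerForm κ hW).quad ψ + β * ‖(ψ : L2Space d)‖ ^ 2 :=
    le_trans (by positivity) (hb ψ)
  have h2 : 0 ≤ (C * (schrodingerForm κ hW).quad ψ + β * ‖(ψ : L2Space d)‖ ^ 2) / C :=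
    div_nonneg h1 hC.le
  have h3 : (C * (schrodingerForm κ hW).quad ψ + β * ‖(ψ : L2Space d)‖ ^ 2) / C =
      (schrodingerForm κ hW).quad ψ + β / C * ‖(ψ : L2Space d)‖ ^ 2 := by
    field_simp
  linarith

/-- The form may have either sign, so convergence of its values alone controls nothing. Coercivity
makes both energies Cauchy separately, and each is complete under `L²` limits. -/
lemma SchrodingerCoercive.closed {κ : ℝ} (hκ : 0 < κ) {W : Space d → ℝ}
    {hW : Measurable W} (h : SchrodingerCoercive κ hW) :
    (schrodingerForm κ hW).Closed := by
  obtain ⟨C, β, hC, hb⟩ := h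
  intro u ψ hu hq
  have hbound : Tendsto (fun p : ℕ × ℕ =>
      κ * (kineticEnergy (u p.1 - u p.2 : L2Space d)).toReal +
        (multEnergy W (u p.1 - u p.2 : L2Space d)).toReal) atTop (𝓝 0) := by
    have hnorm : Tendsto (fun p : ℕ × ℕ => ‖(u p.1 - u p.2 : L2Space d)‖) atTop (𝓝 0) := by
      simpa only [dist_eq_norm] using cauchySeq_iff_tendsto_dist_atTop_0.1 hu.cauchySeq
    have hlim := (hq.const_mul C).add ((hnorm.pow 2).const_mul β)
    simp only [ne_eq, OfNat.ofNat_ne_zero, not_false_eq_true, zero_pow, mul_zero, add_zero]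
      at hlim
    refine squeeze_zero (fun p => by positivity) (fun p => ?_) hlim
    have h := hb (u p.1 - u p.2)
    rwa [Submodule.coe_sub] at h
  have hkin : Tendsto (fun p : ℕ × ℕ => kineticEnergy (u p.1 - u p.2 : L2Space d))
      atTop (𝓝 0) := by
    have hfin : ∀ p : ℕ × ℕ, kineticEnergy (u p.1 - u p.2 : L2Space d) ≠ ∞ := fun p => by
      rw [← Submodule.coe_sub]
      exact (kineticEnergy_lt_top_of_mem_schrodinger _).ne
    refine (ENNReal.tendsto_toReal_iff hfin ENNReal.zero_ne_top).1 ?_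
    refine squeeze_zero (fun p => ENNReal.toReal_nonneg) (fun p => ?_)
      ((hbound.const_mul κ⁻¹).trans_eq (by rw [mul_zero]))
    rw [mul_add, inv_mul_cancel_left₀ hκ.ne']
    exact le_add_of_nonneg_right (by positivity)
  have hpot : Tendsto (fun p : ℕ × ℕ => multEnergy W (u p.1 - u p.2 : L2Space d))
      atTop (𝓝 0) := by
    have hfin : ∀ p : ℕ × ℕ, multEnergy W (u p.1 - u p.2 : L2Space d) ≠ ∞ := fun p => by
      rw [← Submodule.coe_sub]
      exact (multEnergy_lt_top_of_mem_schrodinger _).ne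
    refine (ENNReal.tendsto_toReal_iff hfin ENNReal.zero_ne_top).1 ?_
    exact squeeze_zero (fun p => ENNReal.toReal_nonneg)
      (fun p => le_add_of_nonneg_left (by positivity)) hbound
  obtain ⟨hmem1, hlim1⟩ := kineticEnergy_tendsto_of_cauchy
    (fun n => mem_negLaplacian_of_mem_schrodinger (u n)) hu hkin
  obtain ⟨hmem2, hlim2⟩ := multEnergy_tendsto_of_cauchy hW
    (fun n => mem_multDomain_of_mem_schrodinger (u n)) hu hpot
  have hmem : ψ ∈ (schrodingerForm κ hW).domain := Submodule.mem_inf.2 ⟨hmem1, hmem2⟩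
  have hlim : Tendsto (fun n => κ * (kineticEnergy (u n - ψ : L2Space d)).toReal +
      (multEnergy W (u n - ψ : L2Space d)).toReal) atTop (𝓝 0) := by
    have h1 := (ENNReal.tendsto_toReal ENNReal.zero_ne_top).comp hlim1
    have h2 := (ENNReal.tendsto_toReal ENNReal.zero_ne_top).comp hlim2
    have h3 := (h1.const_mul κ).add h2
    rwa [ENNReal.toReal_zero, mul_zero, add_zero] at h3
  -- Conversely, the absolute value of the form is at most the sum of the two energies.
  refine ⟨hmem, squeeze_zero_norm (fun n => ?_) hlim⟩
  rw [schrodingerForm_quad]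
  refine (norm_add_le _ _).trans (add_le_add (le_of_eq ?_) ?_)
  · rw [Submodule.coe_sub]
    exact Real.norm_of_nonneg (by positivity)
  · have h := abs_multForm_quad_le hW
      ⟨_, mem_multDomain_of_mem_schrodinger (u n - ⟨ψ, hmem⟩)⟩
    dsimp only at h
    nth_rw 2 [Submodule.coe_sub] at h
    exact h

/-- Smooth compactly supported functions are dense in `L²`. They are Schwartz, so of finite kinetic
energy, and `B` is bounded on their supports. -/
lemma schrodingerForm_denselyDefined (κ : ℝ) {W : Space d → ℝ} (hW : Measurable W)
    {B : Space d → ℝ} (hB : Continuous B) (hWB : ∀ x, |W x| ≤ B x) :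
    (schrodingerForm κ hW).DenselyDefined := by
  refine (Lp.dense_hasCompactSupport_contDiff (E := Space d) (F := ℂ)
    (μ := volume) (p := 2) ENNReal.ofNat_ne_top).mono ?_
  rintro f ⟨g, hfg, hg1, hg2⟩
  have hf : f = (hg1.toSchwartzMap hg2).toLp 2 volume := by
    refine Lp.ext ?_
    filter_upwards [hfg, (hg1.toSchwartzMap hg2).coeFn_toLp 2 volume] with x h1 h2
    rw [h1, h2]
    rfl
  refine ⟨?_, ?_⟩
  · rw [hf]
    exact SchwartzMap.toLp_mem_negLaplacianForm_domain _
  · refine (mem_multDomain_iff hW f).2 ?_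
    have hae : ∀ᵐ x, ‖f x‖ = ‖g x‖ := hfg.mono fun x hx => congrArg norm hx
    rw [multEnergy_congr W hae]
    have hint : Integrable (fun x => B x * ‖g x‖ ^ 2) volume := by
      refine Continuous.integrable_of_hasCompactSupport
        (hB.mul (hg2.continuous.norm.pow 2)) (HasCompactSupport.mul_left ?_)
      exact hg1.norm.comp_left (g := fun t : ℝ => t ^ 2) (by norm_num)
    refine lt_of_le_of_lt (lintegral_mono fun x => ?_) hint.2
    rw [enorm_mul, enorm_pow, enorm_norm]
    gcongr
    rw [← Real.enorm_abs]
    exact enorm_le_iff_norm_le.2 ((abs_abs (W x)).trans_le ((hWB x).trans (le_abs_self _)))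
end

/-! ### Existence of the form sum and of `H_eff`. -/

theorem mainTheorem2 (d : ℕ) (hd : 2 ≤ d)
    (hbar m q ε₀ : ℝ) (h_hbar : 0 < hbar) (hm : 0 < m) (hq : q ≠ 0) (hε₀ : 0 < ε₀)
    (ω : Space d → ℝ) (hω_meas : Measurable ω) (hω_nonneg : ∀ k, 0 ≤ ω k)
    (hω_pos : ∀ᵐ k, 0 < ω k)
    (ρ : Space d → ℝ) (hρ_meas : Measurable ρ)
    (hρ_radial : ∀ k k' : Space d, ‖k‖ = ‖k'‖ → ρ k = ρ k')
    (hρ1 : MemLp (fun k => ρ k / ω k ^ (1 / 2 : ℝ)) 2 volume)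
    (hρ1_ne : ¬ (fun k => ρ k / ω k ^ (1 / 2 : ℝ)) =ᵐ[volume] 0)
    (hρ3 : MemLp (fun k => ρ k / ω k ^ (3 / 2 : ℝ)) 2 volume)
    (hρ3_ne : ¬ (fun k => ρ k / ω k ^ (3 / 2 : ℝ)) =ᵐ[volume] 0)
    (a : ℝ) (ha : a = smearingConst d hbar m q ε₀ ω ρ)
    (V : Space d → ℝ) (hV_meas : Measurable V)
    (hV1 : AbsInfinitesimallyFormBounded V hV_meas ∨ ∃ c : ℝ, ∀ x, c ≤ V x)
    (hV2 : ∀ t : ℝ, 0 < t → Integrable (fun x => |V x| * Real.exp (-t * ‖x‖ ^ 2)) volume) :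
    -- the integral defining the effective potential converges absolutely at every point
    (∀ x, Integrable (fun y => V y * Real.exp (-‖x - y‖ ^ 2 / (4 * a))) volume) ∧
    -- in the form-bounded case the effective potential is infinitesimally form-bounded
    (AbsInfinitesimallyFormBounded V hV_meas →
      AbsInfinitesimallyFormBounded (effPotential a V) (measurable_effPotential a hV_meas)) ∧
    -- the form sum exists
    SesqForm.FormSumExists
      ((negLaplacianForm d).smul (hbar ^ 2 / (2 * m)))
      (multForm (effPotential a V) (measurable_effPotential a hV_meas)) ∧
    -- the associated operator `H_eff` exists, is self-adjoint and is bounded from below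
    ∃! Heff : L2Space d →ₗ.[ℂ] L2Space d,
      SesqForm.IsAssociated
        (((negLaplacianForm d).smul (hbar ^ 2 / (2 * m))).add
          (multForm (effPotential a V) (measurable_effPotential a hV_meas))) Heff ∧
      IsSelfAdjoint Heff ∧ OperatorBoundedBelow Heff := by

  have ha0 : 0 < a := ha ▸ smearingConst_pos hd h_hbar hm hq hε₀ hω_nonneg hρ3 hρ3_ne
  have hκ : 0 < hbar ^ 2 / (2 * m) := by positivity
  -- The alternative on `V` is used only here; both cases lead to the same coercivity.
  have hcoer : SchrodingerCoercive (hbar ^ 2 / (2 * m)) (measurable_effPotential a hV_meas) := by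
    rcases hV1 with h | ⟨c, hc⟩
    · exact schrodingerCoercive_of_formBounded hκ (h.effPotential ha0)
    · obtain ⟨C, hC0, hC⟩ := effPotential_bounded_below ha0 hV_meas hV2 hc
      exact schrodingerCoercive_of_bounded_below _ hC0 hC
  obtain ⟨C, -, hC⟩ := abs_effPotential_le ha0 hV2
  have hdense := schrodingerForm_denselyDefined (hbar ^ 2 / (2 * m))
    (measurable_effPotential a hV_meas) (by fun_prop) hC
  have hbelow := hcoer.boundedBelow hκ
  have hclosed := hcoer.closed hκ
  obtain ⟨A, hA⟩ := SesqForm.exists_isAssociated _ hdense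
  exact ⟨integrable_mul_exp_neg_norm_sub_sq ha0 hV_meas hV2, fun h => h.effPotential ha0,
    ⟨hdense, hbelow, hclosed⟩, A,
    ⟨hA, hA.isSelfAdjoint hbelow hclosed, hA.operatorBoundedBelow hbelow⟩,
    -- Association alone fixes the graph, so uniqueness needs neither self-adjointness nor the lower
    -- bound.
    fun B hB => hB.1.unique hA⟩
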